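/- Let $d\ge 0$, $n\ge 1$ be integers, let $q>1$, and let $\mathcal S\subset\{0,1\}^d$ be a non-empty set of actions whose convex hull $\mathrm{Conv}(\mathcal S)$ meets $(0,+\infty)^d$ (equivalently, for every $i$ some $v\in\mathcal S$ has $v_i=1$). **Semi-bandit game.** In each round $t=1,\dots,n$ the forecaster draws an action $V_t\in\mathcal S$ from a distribution $p_t$ on $\mathcal S$, while the adversary simultaneously selects a loss vector $\ell_t\in[0,+\infty)^d$, possibly at random and depending on the past; that is, conditionally on the past, $p_t$ and $\ell_t$, the law of $V_t$ is $p_t$. The forecaster incurs the loss $\ell_t^TV_t$ and observes the coordinates $\ell_{i,t}$ with $V_{i,t}=1$. The regret is $$\overline R_n=\mathbb E\sum_{t=1}^n \ell_t^TV_t-\min_{v\in\mathcal S}\mathbb E\sum_{t=1}^n \ell_t^Tv .$$ **LINPOLY.** Let $\eta=\sqrt{\frac{2}{q(q-1)n}}$, let $\psi(x)=(-\eta x)^{-q}$ for $x<0$, and let $F(u)=\sum_{i=1}^d\int_0^{u_i}\psi^{-1}(s)\,ds=-\frac{q}{(q-1)\eta}\sum_{i=1}^d u_i^{\frac{q-1}{q}}$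 on $[0,+\infty)^d$, with Bregman divergence $D_F(u,v)=F(u)-F(v)-(u-v)^T\nabla F(v)$ for $u\in[0,+\infty)^d$, $v\in(0,+\infty)^d$. The forecaster starts from a point $w_1\in \mathrm{Conv}(\mathcal S)\cap(0,+\infty)^d$ which minimises $D_F\big(w,(1,\dots,1)^T\big)$ over $w\in\mathrm{Conv}(\mathcal S)$. In each round $t=1,\dots,n$ it takes for $p_t$ any distribution on $\mathcal S$ with mean $\mathbb E_{V\sim p_t}V=w_t$, draws $V_t\sim p_t$, forms the estimate $\tilde\ell_{i,t}=\ell_{i,t}\frac{V_{i,t}}{w_{i,t}}$ for $i=1,\dots,d$, takes $w'_{t+1}\in(0,+\infty)^d$ with $\nabla F(w'_{t+1})=\nabla F(w_t)-\tilde\ell_t$, and takes for $w_{t+1}$ a minimiser of $D_F(w,w'_{t+1})$ over $w\in\mathrm{Conv}(\mathcal S)\cap(0,+\infty)^d$. **Claim.** Under the $L_\infty$ assumption, i.e. $\|\ell_t\|_\infty\le 1$ for $t=1,\dots,n$, this forecaster satisfies $$\overline R_n\le d\sqrt{\frac{2qn}{q-1}} .$$ -/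

import Mathlib

open MeasureTheory ProbabilityTheory
open scoped Gradient

noncomputable section

/-- `x` is a minimiser of `f` over the set `s`. -/
def IsArgminOn {α : Type*} (f : α → ℝ) (s : Set α) (x : α) : Prop :=
  x ∈ s ∧ IsMinOn f s x

/-- Bregman divergence `D_F(u, v) = F u - F v - (u - v)ᵀ ∇F(v)`. -/
def bregmanDiv {d : ℕ} (F : EuclideanSpace ℝ (Fin d) → ℝ)
    (u v : EuclideanSpace ℝ (Fin d)) : ℝ :=
  F u - F v - inner ℝ (u - v) (∇ F v)

/-- One trajectory of the forecaster CLEB (combinatorial learning with Bregman projections) with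
potential `F` on the domain `D` and action set `S`, run for the `n` rounds `t = 0, …, n - 1`:
`w t` is the weight vector, `p t` the distribution on `S` used to draw the action of round `t`,
and `est t` the loss estimate formed at the end of round `t`. -/
structure IsCleb {d : ℕ} (D : Set (EuclideanSpace ℝ (Fin d)))
    (F : EuclideanSpace ℝ (Fin d) → ℝ) (S : Finset (EuclideanSpace ℝ (Fin d))) (n : ℕ)
    (est w : ℕ → EuclideanSpace ℝ (Fin d)) (p : ℕ → EuclideanSpace ℝ (Fin d) → ℝ) : Prop where
  init_mem : w 0 ∈ convexHull ℝ (S : Set (EuclideanSpace ℝ (Fin d))) ∩ interior D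
  /-- `p t` is a probability distribution on `S` with mean `w t`. -/
  prob_nonneg : ∀ t < n, ∀ v ∈ S, 0 ≤ p t v
  prob_sum : ∀ t < n, ∑ v ∈ S, p t v = 1
  prob_mean : ∀ t < n, ∑ v ∈ S, p t v • v = w t
  /-- Gradient step in the dual, followed by a Bregman projection. -/
  update : ∀ t < n, ∃ w' ∈ interior D, ∇ F w' = ∇ F (w t) - est t ∧
    IsArgminOn (fun u => bregmanDiv F u w')
      (convexHull ℝ (S : Set (EuclideanSpace ℝ (Fin d))) ∩ interior D) (w (t + 1))

/-- The domain `[ω, +∞)^d`. -/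
def orthant (d : ℕ) (ω : ℝ) : Set (EuclideanSpace ℝ (Fin d)) :=
  {u | ∀ i, ω ≤ u i}

/-- The function `F(u) = ∑ i, ∫_ω^{u_i} ψ⁻¹(s) ds` attached to a potential
`ψ : (-∞, a) → (ω, +∞)`. -/
def lininfF {d : ℕ} (ψ : ℝ → ℝ) (a ω : ℝ) (u : EuclideanSpace ℝ (Fin d)) : ℝ :=
  ∑ i, ∫ s in ω..u i, Function.invFunOn ψ (Set.Iio a) s

/-- The polynomial potential `ψ(x) = (-η x)^{-q}`, to be used on `(-∞, 0)`. -/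
def polyPotential (q η : ℝ) (x : ℝ) : ℝ :=
  (-η * x) ^ (-q)

/-- The function `F` of the forecaster LINPOLY, on the domain `[0, +∞)^d`. -/
def linpolyF {d : ℕ} (q η : ℝ) : EuclideanSpace ℝ (Fin d) → ℝ :=
  lininfF (polyPotential q η) 0 0

/-- The importance-weighted loss estimate `ℓ i * V i / w i`. For `V ∈ {0,1}^d` it only uses the
coordinates `ℓ i` with `V i = 1`, those that are observed in the semi-bandit game. -/
def importanceWeighted {d : ℕ} (ℓ V w : EuclideanSpace ℝ (Fin d)) : EuclideanSpace ℝ (Fin d) :=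
  WithLp.toLp 2 fun i => ℓ i * (V i / w i)

/-- The combinatorial prediction game over `n` rounds `t = 0, …, n - 1`, against an arbitrary
(adaptive, possibly randomised) adversary. `𝒢 t` is all the information that exists just before
the action of round `t` is drawn: the past actions and losses, the distribution `p t` chosen by
the forecaster, and the loss vector `ℓ t` chosen simultaneously by the adversary. Given `𝒢 t`,
the action `V t` is drawn from `p t`. -/
structure IsGamePlay {d : ℕ} {Ω : Type*} [mΩ : MeasurableSpace Ω] (μ : Measure Ω)
    (𝒢 : Filtration ℕ mΩ) (S : Finset (EuclideanSpace ℝ (Fin d))) (n : ℕ)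
    (ℓ V : ℕ → Ω → EuclideanSpace ℝ (Fin d))
    (p : ℕ → Ω → EuclideanSpace ℝ (Fin d) → ℝ) : Prop where
  loss_nonneg : ∀ t < n, ∀ ω i, 0 ≤ ℓ t ω i
  loss_measurable : ∀ t < n, Measurable[𝒢 t] (ℓ t)
  prob_measurable : ∀ t < n, ∀ v ∈ S, Measurable[𝒢 t] (fun ω => p t ω v)
  action_mem : ∀ t < n, ∀ ω, V t ω ∈ S
  action_measurable : ∀ t < n, Measurable[𝒢 (t + 1)] (V t)
  action_law : ∀ t < n, ∀ v ∈ S,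
    μ[(V t ⁻¹' {v}).indicator (fun _ => (1 : ℝ)) | 𝒢 t] =ᵐ[μ] fun ω => p t ω v

/-- The `L_∞` assumption: `‖ℓ_t‖_∞ ≤ 1` in every round (the norm of `Fin d → ℝ` is the
sup norm). -/
def LInftyAssumption {d : ℕ} {Ω : Type*} (n : ℕ) (ℓ : ℕ → Ω → EuclideanSpace ℝ (Fin d)) : Prop :=
  ∀ t < n, ∀ ω, ‖WithLp.ofLp (ℓ t ω)‖ ≤ 1

/-- The regret `E ∑ t, ℓ_tᵀ V_t - min_{v ∈ S} E ∑ t, ℓ_tᵀ v`. -/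
def regret {d : ℕ} {Ω : Type*} [MeasurableSpace Ω] (μ : Measure Ω)
    (S : Finset (EuclideanSpace ℝ (Fin d))) (hS : S.Nonempty) (n : ℕ)
    (ℓ V : ℕ → Ω → EuclideanSpace ℝ (Fin d)) : ℝ :=
  (∫ ω, ∑ t ∈ Finset.range n, inner ℝ (ℓ t ω) (V t ω) ∂μ) -
    S.inf' hS (fun v => ∫ ω, ∑ t ∈ Finset.range n, inner ℝ (ℓ t ω) v ∂μ)

/-- The inverse of the polynomial potential is `s ↦ -(1/η) s^{-1/q}` on `(0, +∞)`. -/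
theorem invFunOn_polyPotential {q η : ℝ} (hq : 1 < q) (hη : 0 < η) {s : ℝ} (hs : 0 < s) :
    Function.invFunOn (polyPotential q η) (Set.Iio 0) s = -(1 / η) * s ^ (-(1 / q)) := by
  have hq0 : q ≠ 0 := by positivity
  have hpre : polyPotential q η (-(1 / η) * s ^ (-(1 / q))) = s := by
    have h : -η * (-(1 / η) * s ^ (-(1 / q))) = s ^ (-(1 / q)) := by field_simp
    rw [polyPotential, h, ← Real.rpow_mul hs.le]
    have h2 : -(1 / q) * -q = 1 := by field_simp
    rw [h2, Real.rpow_one]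
  have hmem : -(1 / η) * s ^ (-(1 / q)) ∈ Set.Iio (0 : ℝ) := by
    have : 0 < (1 / η) * s ^ (-(1 / q)) := by positivity
    simp only [Set.mem_Iio]; linarith
  have hex : ∃ x ∈ Set.Iio (0 : ℝ), polyPotential q η x = s := ⟨_, hmem, hpre⟩
  have h1 := Function.invFunOn_mem hex
  have h2 := Function.invFunOn_eq hex
  have hinj : Set.InjOn (polyPotential q η) (Set.Iio 0) := by
    intro x hx y hy hxy
    simp only [Set.mem_Iio] at hx hy
    have hx' : 0 ≤ -η * x := by nlinarith
    have hy' : 0 ≤ -η * y := by nlinarith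
    have := (Real.rpow_left_inj hx' hy' (neg_ne_zero.mpr hq0)).mp hxy
    exact mul_left_cancel₀ (neg_ne_zero.mpr hη.ne') this
  exact hinj h1 hmem (h2.trans hpre.symm)

/-- Closed form of the LINPOLY function on its domain. -/
theorem linpolyF_eq {d : ℕ} {q η : ℝ} (hq : 1 < q) (hη : 0 < η)
    {u : EuclideanSpace ℝ (Fin d)} (hu : u ∈ orthant d 0) :
    linpolyF q η u = -(q / ((q - 1) * η)) * ∑ i, u i ^ ((q - 1) / q) := by
  have hq0 : 0 < q := by positivity
  have hq1 : q - 1 ≠ 0 := by linarith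
  rw [linpolyF, lininfF, Finset.mul_sum]
  refine Finset.sum_congr rfl fun i _ => ?_
  have hc : ∫ s in (0 : ℝ)..u i, Function.invFunOn (polyPotential q η) (Set.Iio 0) s =
      ∫ s in (0 : ℝ)..u i, -(1 / η) * s ^ (-(1 / q)) := by
    refine intervalIntegral.integral_congr_ae (Filter.Eventually.of_forall fun s hs => ?_)
    rw [Set.uIoc_of_le (hu i)] at hs
    exact invFunOn_polyPotential hq hη hs.1
  have hlt : -1 < -(1 / q) := by
    have : 1 / q < 1 := by rw [div_lt_one hq0]; exact hq
    linarith
  have he : -(1 / q) + 1 = (q - 1) / q := by field_simp; ring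
  rw [hc, intervalIntegral.integral_const_mul, integral_rpow (Or.inl hlt), he,
    Real.zero_rpow (div_ne_zero hq1 hq0.ne')]
  field_simp
  ring

end

/-!
Each round is a gradient step from `w t` to a point `x t`, followed by a Bregman projection onto the
hull. The three-point identity for Bregman divergences and the generalised Pythagorean inequality
for the projection make the sum of `⟪est t, w t - u⟫` telescope: it is at most `D_F(u, w 0)` plus
the local divergences `D_F(w t, x t)`.

For the polynomial potential, each coordinate of `D_F(w, x)` is a second-order Taylor remainder of
the convex function `s ↦ s ^ (-(q - 1))` between the dual points `w ^ (-1/q)` and `x ^ (-1/q)`,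
which differ by `η * est ≥ 0`. Since the second derivative is decreasing, the local divergence is at
most `(q η / 2) ∑ i, est i ^ 2 * w i ^ (1 + 1/q)`.

Conditionally on the past, `V t` has mean `w t`, so `est t` has the same expectation as `ℓ t`, and
`est i ^ 2 * w i ^ (1 + 1/q) ≤ w i ^ (1/q - 1) * V i` has expectation at most `E[w i ^ (1/q)] ≤ 1`.
As the weights are not bounded away from `0`, the integrability of these ratios has to come from
the nonnegativity of the actions. The regret is thus at most `d / ((q - 1) η) + n q η d / 2`, and
the given `η` makes the two terms equal.
-/

section BregmanDivergence

variable {d : ℕ} {F : EuclideanSpace ℝ (Fin d) → ℝ} {u v w : EuclideanSpace ℝ (Fin d)}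

theorem bregmanDiv_nonneg {D : Set (EuclideanSpace ℝ (Fin d))} (hF : ConvexOn ℝ D F)
    (hFv : DifferentiableAt ℝ F v) (hu : u ∈ D) (hv : v ∈ D) : 0 ≤ bregmanDiv F u v := by
  have hconv := hF.comp_affineMap (AffineMap.lineMap v u)
  have hderiv : HasDerivAt (F ∘ AffineMap.lineMap (k := ℝ) v u) (inner ℝ (∇ F v) (u - v)) 0 := by
    have hFv' := hFv.hasGradientAt.hasFDerivAt
    rw [← AffineMap.lineMap_apply_zero (k := ℝ) v u] at hFv'
    simpa using hFv'.comp_hasDerivAt (0 : ℝ) AffineMap.hasDerivAt_lineMap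
  have hslope := hconv.le_slope_of_hasDerivAt (by simpa) (by simpa) zero_lt_one hderiv
  rw [real_inner_comm] at hslope
  simpa [slope_def_field, bregmanDiv] using hslope

theorem bregmanDiv_three_point (F : EuclideanSpace ℝ (Fin d) → ℝ)
    (u v w : EuclideanSpace ℝ (Fin d)) :
    bregmanDiv F u v + bregmanDiv F v w - bregmanDiv F u w =
      inner ℝ (u - v) (∇ F w - ∇ F v) := by
  simp only [bregmanDiv, inner_sub_left, inner_sub_right]
  ring

theorem hasGradientAt_bregmanDiv_left (hF : DifferentiableAt ℝ F v)
    (w : EuclideanSpace ℝ (Fin d)) :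
    HasGradientAt (fun x => bregmanDiv F x w) (∇ F v - ∇ F w) v := by
  have hlin : HasFDerivAt (fun x => inner ℝ (x - w) (∇ F w))
      (InnerProductSpace.toDual ℝ _ (∇ F w)) v := by
    simpa [real_inner_comm] using
      ((InnerProductSpace.toDual ℝ _ (∇ F w)).hasFDerivAt (x := v)).sub_const (inner ℝ w (∇ F w))
  rw [hasGradientAt_iff_hasFDerivAt, map_sub]
  exact (hF.hasGradientAt.hasFDerivAt.sub_const (F w)).sub hlin

theorem bregmanDiv_add_bregmanDiv_le_of_isLocalMinOn {C : Set (EuclideanSpace ℝ (Fin d))}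
    (hC : Convex ℝ C) (hu : u ∈ C) (hv : v ∈ C) (hF : DifferentiableAt ℝ F v)
    (hmin : IsLocalMinOn (fun x => bregmanDiv F x w) C v) :
    bregmanDiv F u v + bregmanDiv F v w ≤ bregmanDiv F u w := by
  have hfirst_order : 0 ≤ inner ℝ (∇ F v - ∇ F w) (u - v) :=
    hmin.hasFDerivWithinAt_nonneg
      (hasGradientAt_bregmanDiv_left hF w).hasFDerivAt.hasFDerivWithinAt
      (sub_mem_posTangentConeAt_of_segment_subset (hC.segment_subset hv hu))
  rw [real_inner_comm, ← neg_sub (∇ F w), inner_neg_right] at hfirst_order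
  linarith [bregmanDiv_three_point F u v w]

end BregmanDivergence

namespace IsCleb

variable {d n : ℕ} {D : Set (EuclideanSpace ℝ (Fin d))} {F : EuclideanSpace ℝ (Fin d) → ℝ}
  {S : Finset (EuclideanSpace ℝ (Fin d))} {est w : ℕ → EuclideanSpace ℝ (Fin d)}
  {p : ℕ → EuclideanSpace ℝ (Fin d) → ℝ}

theorem weight_mem (h : IsCleb D F S n est w p) :
    ∀ t ≤ n, w t ∈ convexHull ℝ (S : Set (EuclideanSpace ℝ (Fin d))) ∩ interior D
  | 0, _ => h.init_mem
  | t + 1, ht => by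
    obtain ⟨_, -, -, hw⟩ := h.update t ht
    exact hw.1

theorem exists_inner_estimate_add_bregmanDiv_le (h : IsCleb D F S n est w p)
    (hconv : ConvexOn ℝ D F) (hdiff : ∀ v ∈ interior D, DifferentiableAt ℝ F v)
    {u : EuclideanSpace ℝ (Fin d)} (hu : u ∈ convexHull ℝ (S : Set (EuclideanSpace ℝ (Fin d))))
    {t : ℕ} (ht : t < n) :
    ∃ w' ∈ interior D, ∇ F w' = ∇ F (w t) - est t ∧
      inner ℝ (est t) (w t - u) + bregmanDiv F u (w (t + 1)) ≤
        bregmanDiv F u (w t) + bregmanDiv F (w t) w' := by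
  obtain ⟨w', hw', hgrad, hmem, hmin⟩ := h.update t ht
  refine ⟨w', hw', hgrad, ?_⟩
  -- `w (t + 1)` lies in the open set `interior D`, so it minimises locally over the whole hull;
  -- this lets `u` be a boundary point of `D`, as vertices of the hull can be.
  have hlocal : IsLocalMinOn (fun x => bregmanDiv F x w') (convexHull ℝ S) (w (t + 1)) := by
    have hlocal' := hmin.localize
    rwa [IsLocalMinOn, nhdsWithin_inter_of_mem'
      (nhdsWithin_le_nhds (isOpen_interior.mem_nhds hmem.2))] at hlocal'
  have hpyth := bregmanDiv_add_bregmanDiv_le_of_isLocalMinOn (convex_convexHull ℝ _) hu hmem.1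
    (hdiff _ hmem.2) hlocal
  have hproj_nonneg := bregmanDiv_nonneg hconv (hdiff _ hw') (interior_subset hmem.2)
    (interior_subset hw')
  have hthree := bregmanDiv_three_point F u (w t) w'
  rw [hgrad, sub_sub_cancel_left, inner_neg_right, ← inner_neg_left, neg_sub,
    real_inner_comm] at hthree
  linarith

theorem sum_inner_estimate_le (h : IsCleb D F S n est w p)
    (hconv : ConvexOn ℝ D F) (hdiff : ∀ v ∈ interior D, DifferentiableAt ℝ F v)
    {u : EuclideanSpace ℝ (Fin d)} (hu : u ∈ convexHull ℝ (S : Set (EuclideanSpace ℝ (Fin d))))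
    (huD : u ∈ D) {c : ℕ → ℝ}
    (hc : ∀ t < n, ∀ w' ∈ interior D, ∇ F w' = ∇ F (w t) - est t →
      bregmanDiv F (w t) w' ≤ c t) :
    ∑ t ∈ Finset.range n, inner ℝ (est t) (w t - u) ≤
      bregmanDiv F u (w 0) + ∑ t ∈ Finset.range n, c t := by
  have hround : ∀ t ∈ Finset.range n, inner ℝ (est t) (w t - u) ≤
      bregmanDiv F u (w t) - bregmanDiv F u (w (t + 1)) + c t := by
    intro t ht
    obtain ⟨w', hw', hgrad, hle⟩ :=
      h.exists_inner_estimate_add_bregmanDiv_le hconv hdiff hu (Finset.mem_range.1 ht)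
    linarith [hc t (Finset.mem_range.1 ht) w' hw' hgrad]
  have hlast : 0 ≤ bregmanDiv F u (w n) :=
    have hn := (h.weight_mem n le_rfl).2
    bregmanDiv_nonneg hconv (hdiff _ hn) huD (interior_subset hn)
  calc ∑ t ∈ Finset.range n, inner ℝ (est t) (w t - u)
      ≤ ∑ t ∈ Finset.range n, (bregmanDiv F u (w t) - bregmanDiv F u (w (t + 1)) + c t) :=
        Finset.sum_le_sum hround
    _ = bregmanDiv F u (w 0) - bregmanDiv F u (w n) + ∑ t ∈ Finset.range n, c t := by
        rw [Finset.sum_add_distrib, Finset.sum_range_sub' fun t => bregmanDiv F u (w t)]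
    _ ≤ bregmanDiv F u (w 0) + ∑ t ∈ Finset.range n, c t := by linarith

theorem bregmanDiv_init_le (h : IsCleb D F S n est w p)
    (hconv : ConvexOn ℝ D F) (hdiff : ∀ v ∈ interior D, DifferentiableAt ℝ F v)
    {u x : EuclideanSpace ℝ (Fin d)} (hu : u ∈ convexHull ℝ (S : Set (EuclideanSpace ℝ (Fin d))))
    (hx : x ∈ interior D)
    (hw : IsMinOn (fun y => bregmanDiv F y x)
      (convexHull ℝ (S : Set (EuclideanSpace ℝ (Fin d)))) (w 0)) :
    bregmanDiv F u (w 0) ≤ bregmanDiv F u x := by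
  obtain ⟨hmem, hint⟩ := h.init_mem
  have hpyth := bregmanDiv_add_bregmanDiv_le_of_isLocalMinOn (convex_convexHull ℝ _) hu hmem
    (hdiff _ hint) hw.localize
  have hproj_nonneg := bregmanDiv_nonneg hconv (hdiff _ hx) (interior_subset hint)
    (interior_subset hx)
  linarith

end IsCleb

theorem hasGradientAt_sum_apply {ι : Type*} [Fintype ι] {f : ι → ℝ → ℝ} {f' : ι → ℝ}
    {u : EuclideanSpace ℝ ι} (hf : ∀ i, HasDerivAt (f i) (f' i) (u i)) :
    HasGradientAt (fun v : EuclideanSpace ℝ ι => ∑ i, f i (v i)) (WithLp.toLp 2 f') u := by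
  have hsum := HasFDerivAt.fun_sum fun i (_ : i ∈ Finset.univ) =>
    (hf i).comp_hasFDerivAt u (EuclideanSpace.proj i : EuclideanSpace ℝ ι →L[ℝ] ℝ).hasFDerivAt
  rw [hasGradientAt_iff_hasFDerivAt]
  refine hsum.congr_fderiv ?_
  ext v
  simp [PiLp.inner_apply, mul_comm]

theorem interior_orthant (d : ℕ) (a : ℝ) :
    interior (orthant d a) = {u : EuclideanSpace ℝ (Fin d) | ∀ i, a < u i} := by
  have hpre : orthant d a =
      EuclideanSpace.equiv (Fin d) ℝ ⁻¹' Set.univ.pi fun _ => Set.Ici a := by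
    ext u
    simp only [orthant, Set.mem_preimage, Set.mem_univ_pi, Set.mem_Ici]
    rfl
  rw [hpre, ← ContinuousLinearEquiv.coe_toHomeomorph, ← Homeomorph.preimage_interior,
    interior_pi_set Set.finite_univ]
  ext u
  simp

theorem convexOn_finsetSum {𝕜 E β ι : Type*} [Semiring 𝕜] [PartialOrder 𝕜] [AddCommMonoid E]
    [AddCommMonoid β] [PartialOrder β] [IsOrderedAddMonoid β] [SMul 𝕜 E] [Module 𝕜 β]
    {s : Set E} {f : ι → E → β} {I : Finset ι} (hs : Convex 𝕜 s)
    (hf : ∀ i ∈ I, ConvexOn 𝕜 s (f i)) : ConvexOn 𝕜 s fun x => ∑ i ∈ I, f i x := by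
  refine ⟨hs, fun x hx y hy a b ha hb hab => ?_⟩
  rw [Finset.smul_sum, Finset.smul_sum, ← Finset.sum_add_distrib]
  exact Finset.sum_le_sum fun i hi => (hf i hi).2 hx hy ha hb hab

theorem convex_orthant (d : ℕ) (a : ℝ) : Convex ℝ (orthant d a) := by
  intro u hu v hv r s hr hs hrs i
  exact convex_Ici a (hu i) (hv i) hr hs hrs

theorem one_sub_mul_le_rpow_neg {p x : ℝ} (hp : 0 ≤ p) (hx : 0 < x) :
    1 - p * (x - 1) ≤ x ^ (-p) := by
  rw [Real.rpow_def_of_pos hx]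
  have hexp := Real.add_one_le_exp (Real.log x * -p)
  have hlog := mul_le_mul_of_nonneg_left (Real.log_le_sub_one_of_pos hx) hp
  linarith

theorem rpow_neg_le_quadratic {p x : ℝ} (hp : 0 ≤ p) (hx : 1 ≤ x) :
    x ^ (-p) ≤ 1 - p * (x - 1) + p * (p + 1) / 2 * (x - 1) ^ 2 := by
  have hquad (y : ℝ) : HasDerivAt (fun y => 1 - p * (y - 1) + p * (p + 1) / 2 * (y - 1) ^ 2)
      (-p * (1 - (p + 1) * (y - 1))) y := by
    have hsub := (hasDerivAt_id y).sub_const 1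
    refine (((hsub.const_mul p).const_sub 1).add
      ((hsub.pow 2).const_mul (p * (p + 1) / 2))).congr_deriv ?_
    simp only [id_eq]
    ring
  have hpow (y : ℝ) (hy : 1 ≤ y) : HasDerivAt (fun y => y ^ (-p)) (-p * y ^ (-(p + 1))) y := by
    rw [neg_add']
    exact Real.hasDerivAt_rpow_const (Or.inl (zero_lt_one.trans_le hy).ne')
  refine image_le_of_deriv_right_le_deriv_boundary (a := 1) (b := x)
    (fun y hy => (hpow y hy.1).continuousAt.continuousWithinAt)
    (fun y hy => (hpow y hy.1).hasDerivWithinAt) (by simp)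
    (fun y _ => (hquad y).continuousAt.continuousWithinAt)
    (fun y _ => (hquad y).hasDerivWithinAt) (fun y hy => ?_) ⟨hx, le_rfl⟩
  exact mul_le_mul_of_nonpos_left
    (one_sub_mul_le_rpow_neg (by linarith) (zero_lt_one.trans_le hy.1)) (by linarith)

theorem rpow_neg_le_taylor {p a b : ℝ} (hp : 0 ≤ p) (ha : 0 < a) (hab : a ≤ b) :
    b ^ (-p) ≤ a ^ (-p) - p * a ^ (-(p + 1)) * (b - a) +
      p * (p + 1) / 2 * a ^ (-(p + 2)) * (b - a) ^ 2 := by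
  have hb : b ^ (-p) = a ^ (-p) * (b / a) ^ (-p) := by
    rw [← Real.mul_rpow ha.le (div_nonneg (ha.le.trans hab) ha.le), mul_div_cancel₀ b ha.ne']
  have h1 : a ^ (-(p + 1)) = a ^ (-p) / a := by
    rw [neg_add', Real.rpow_sub_one ha.ne']
  have h2 : a ^ (-(p + 2)) = a ^ (-p) / a ^ 2 := by
    rw [neg_add', Real.rpow_sub ha, Real.rpow_two]
  rw [hb, h1, h2]
  refine (mul_le_mul_of_nonneg_left
    (rpow_neg_le_quadratic hp ((one_le_div ha).2 hab)) (by positivity)).trans_eq ?_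
  field_simp

theorem rpow_sub_one_div {q x : ℝ} (hx : 0 < x) (hq : q ≠ 0) :
    x ^ ((q - 1) / q) = x * x ^ (-(1 / q)) := by
  rw [sub_div, div_self hq, sub_eq_add_neg, Real.rpow_add hx, Real.rpow_one]

theorem rpow_sub_one_div_le_of_rpow_eq_add {q x y δ : ℝ} (hq : 1 < q) (hx : 0 < x) (hy : 0 < y)
    (hδ : 0 ≤ δ) (hxy : y ^ (-(1 / q)) = x ^ (-(1 / q)) + δ) :
    y ^ ((q - 1) / q) ≤ x ^ ((q - 1) / q) - (q - 1) * x * δ +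
      (q - 1) * q / 2 * x ^ (1 + 1 / q) * δ ^ 2 := by
  have hq0 : q ≠ 0 := by positivity
  have hrpow {z : ℝ} (hz : 0 < z) {r s : ℝ} (hrs : r = q * s) :
      (z ^ (-(1 / q))) ^ (-r) = z ^ s := by
    rw [← Real.rpow_mul hz.le, hrs]
    congr 1
    field_simp
  -- `s ↦ s ^ (-(q - 1))` is, up to scaling and reflection, the convex conjugate of each summand of
  -- `linpolyF`.
  have htaylor := rpow_neg_le_taylor (sub_pos.2 hq).le (Real.rpow_pos_of_pos hx (-(1 / q)))
    (hxy ▸ le_add_of_nonneg_right hδ : x ^ (-(1 / q)) ≤ y ^ (-(1 / q)))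
  rwa [hrpow hy (s := (q - 1) / q) (by field_simp), hrpow hx (s := (q - 1) / q) (by field_simp),
    hrpow hx (s := 1) (by ring), hrpow hx (s := 1 + 1 / q) (by field_simp; ring),
    Real.rpow_one, hxy, add_sub_cancel_left, sub_add_cancel] at htaylor

section Linpoly

variable {d : ℕ} {q η : ℝ} {u v : EuclideanSpace ℝ (Fin d)}

theorem convexOn_linpolyF (hq : 1 < q) (hη : 0 < η) :
    ConvexOn ℝ (orthant d 0) (linpolyF q η) := by
  have : 0 < q - 1 := sub_pos.2 hq
  have hconcave (i : Fin d) :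
      ConcaveOn ℝ (orthant d 0) fun u : EuclideanSpace ℝ (Fin d) => u i ^ ((q - 1) / q) :=
    ((Real.concaveOn_rpow (by positivity)
      ((div_le_one (by positivity)).2 (by linarith))).comp_linearMap
      (EuclideanSpace.proj i : EuclideanSpace ℝ (Fin d) →L[ℝ] ℝ).toLinearMap).subset
      (fun u hu => hu i) (convex_orthant d 0)
  have hsum : ConvexOn ℝ (orthant d 0) fun u : EuclideanSpace ℝ (Fin d) =>
      q / ((q - 1) * η) * ∑ i, -u i ^ ((q - 1) / q) :=
    (convexOn_finsetSum (convex_orthant d 0) fun i _ => (hconcave i).neg).smul (by positivity)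
  refine hsum.congr fun u hu => ?_
  simp only [linpolyF_eq hq hη hu, Finset.sum_neg_distrib, neg_mul, mul_neg]

theorem hasGradientAt_linpolyF (hq : 1 < q) (hη : 0 < η) (hu : u ∈ interior (orthant d 0)) :
    HasGradientAt (linpolyF q η) (WithLp.toLp 2 fun i => -(1 / η) * u i ^ (-(1 / q))) u := by
  have hq1 : q - 1 ≠ 0 := (sub_pos.2 hq).ne'
  have hq0 : q ≠ 0 := by positivity
  have hpos : ∀ i, 0 < u i := by rwa [interior_orthant] at hu
  have hclosed : linpolyF q η =ᶠ[nhds u]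
      fun v => ∑ i, -(q / ((q - 1) * η)) * v i ^ ((q - 1) / q) := by
    filter_upwards [isOpen_interior.mem_nhds hu] with v hv
    rw [linpolyF_eq hq hη (interior_subset hv), Finset.mul_sum]
  refine HasGradientAt.congr_of_eventuallyEq (hasGradientAt_sum_apply
    (f := fun _ x => -(q / ((q - 1) * η)) * x ^ ((q - 1) / q)) fun i => ?_) hclosed
  refine ((Real.hasDerivAt_rpow_const (Or.inl (hpos i).ne')).const_mul _).congr_deriv ?_
  rw [show (q - 1) / q - 1 = -(1 / q) by field_simp; ring]
  field_simp

theorem bregmanDiv_linpolyF (hq : 1 < q) (hη : 0 < η) (hu : u ∈ orthant d 0)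
    (hv : v ∈ interior (orthant d 0)) :
    bregmanDiv (linpolyF q η) u v = 1 / ((q - 1) * η) * ∑ i,
      (v i ^ ((q - 1) / q) + (q - 1) * (u i * v i ^ (-(1 / q))) - q * u i ^ ((q - 1) / q)) := by
  have hq0 : q ≠ 0 := by positivity
  have hq1 : q - 1 ≠ 0 := (sub_pos.2 hq).ne'
  have hpos : ∀ i, 0 < v i := by rwa [interior_orthant] at hv
  rw [bregmanDiv, (hasGradientAt_linpolyF hq hη hv).gradient, linpolyF_eq hq hη hu,
    linpolyF_eq hq hη (interior_subset hv), PiLp.inner_apply, Finset.mul_sum, Finset.mul_sum,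
    Finset.mul_sum, ← Finset.sum_sub_distrib, ← Finset.sum_sub_distrib]
  refine Finset.sum_congr rfl fun i _ => ?_
  simp only [PiLp.sub_apply, rpow_sub_one_div (hpos i) hq0, RCLike.inner_apply, conj_trivial]
  field_simp
  ring

theorem bregmanDiv_linpolyF_one_le (hq : 1 < q) (hη : 0 < η) (hu : ∀ i, u i ∈ Set.Icc (0 : ℝ) 1) :
    bregmanDiv (linpolyF q η) u (WithLp.toLp 2 fun _ => (1 : ℝ)) ≤ d / ((q - 1) * η) := by
  have : 0 < q - 1 := sub_pos.2 hq
  rw [bregmanDiv_linpolyF hq hη (fun i => (hu i).1) (by simp [interior_orthant]),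
    one_div_mul_eq_div, div_le_div_iff_of_pos_right (by positivity)]
  have hcoord : ∀ i ∈ Finset.univ, (1 : ℝ) ^ ((q - 1) / q) + (q - 1) * (u i * 1 ^ (-(1 / q))) -
      q * u i ^ ((q - 1) / q) ≤ 1 := by
    intro i _
    have hle : u i ≤ u i ^ ((q - 1) / q) :=
      Real.self_le_rpow_of_le_one (hu i).1 (hu i).2 ((div_le_one (by positivity)).2 (by linarith))
    rw [Real.one_rpow, Real.one_rpow]
    nlinarith [(hu i).1]
  simpa using Finset.sum_le_sum hcoord

theorem bregmanDiv_linpolyF_le_of_gradient_eq_sub (hq : 1 < q) (hη : 0 < η)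
    (hu : u ∈ interior (orthant d 0)) (hv : v ∈ interior (orthant d 0))
    {g : EuclideanSpace ℝ (Fin d)} (hg : ∀ i, 0 ≤ g i)
    (hgrad : ∇ (linpolyF q η) v = ∇ (linpolyF q η) u - g) :
    bregmanDiv (linpolyF q η) u v ≤ q * η / 2 * ∑ i, g i ^ 2 * u i ^ (1 + 1 / q) := by
  have hq1 : 0 < q - 1 := sub_pos.2 hq
  have hupos : ∀ i, 0 < u i := by rwa [interior_orthant] at hu
  have hvpos : ∀ i, 0 < v i := by rwa [interior_orthant] at hv
  rw [(hasGradientAt_linpolyF hq hη hu).gradient,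
    (hasGradientAt_linpolyF hq hη hv).gradient] at hgrad
  have hdual (i : Fin d) : v i ^ (-(1 / q)) = u i ^ (-(1 / q)) + η * g i := by
    have hi := congrArg (fun x : EuclideanSpace ℝ (Fin d) => x i) hgrad
    simp only [PiLp.sub_apply] at hi
    field_simp at hi
    linarith
  rw [bregmanDiv_linpolyF hq hη (interior_subset hu) hv, Finset.mul_sum, Finset.mul_sum]
  refine Finset.sum_le_sum fun i _ => ?_
  have htaylor := rpow_sub_one_div_le_of_rpow_eq_add hq (hupos i) (hvpos i)
    (mul_nonneg hη.le (hg i)) (hdual i)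
  rw [one_div_mul_eq_div, div_le_iff₀ (by positivity), hdual i, mul_add,
    ← rpow_sub_one_div (hupos i) (by positivity)]
  linarith

theorem IsCleb.sum_inner_estimate_le_of_linpolyF (hq : 1 < q) (hη : 0 < η) {n : ℕ}
    {S : Finset (EuclideanSpace ℝ (Fin d))} {est w : ℕ → EuclideanSpace ℝ (Fin d)}
    {p : ℕ → EuclideanSpace ℝ (Fin d) → ℝ}
    (h : IsCleb (orthant d 0) (linpolyF q η) S n est w p)
    (hw : IsMinOn (fun u => bregmanDiv (linpolyF q η) u (WithLp.toLp 2 fun _ => (1 : ℝ)))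
      (convexHull ℝ (S : Set (EuclideanSpace ℝ (Fin d)))) (w 0))
    (hest : ∀ t < n, ∀ i, 0 ≤ est t i)
    (hu : u ∈ convexHull ℝ (S : Set (EuclideanSpace ℝ (Fin d))))
    (hu01 : ∀ i, u i ∈ Set.Icc (0 : ℝ) 1) :
    ∑ t ∈ Finset.range n, inner ℝ (est t) (w t - u) ≤
      d / ((q - 1) * η) +
        ∑ t ∈ Finset.range n, q * η / 2 * ∑ i, est t i ^ 2 * w t i ^ (1 + 1 / q) := by
  have hconv := convexOn_linpolyF (d := d) hq hη
  have hdiff : ∀ v ∈ interior (orthant d 0), DifferentiableAt ℝ (linpolyF q η) v :=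
    fun v hv => (hasGradientAt_linpolyF hq hη hv).differentiableAt
  have hinit := (h.bregmanDiv_init_le hconv hdiff hu (by simp [interior_orthant]) hw).trans
    (bregmanDiv_linpolyF_one_le hq hη hu01)
  have hregret := h.sum_inner_estimate_le hconv hdiff hu (fun i => (hu01 i).1)
    fun t ht w' hw' hgrad => bregmanDiv_linpolyF_le_of_gradient_eq_sub hq hη
      (h.weight_mem t ht.le).2 hw' (hest t ht) hgrad
  linarith

end Linpoly

section ConditionalExpectation

variable {Ω : Type*} {m mΩ : MeasurableSpace Ω} {μ : Measure Ω}

theorem lintegral_mul_condLExp (hm : m ≤ mΩ) [SigmaFinite (μ.trim hm)] {g X : Ω → ENNReal}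
    (hg : Measurable[m] g) (hX : AEMeasurable X μ) :
    ∫⁻ ω, g ω * μ⁻[X|m] ω ∂μ = ∫⁻ ω, g ω * X ω ∂μ := by
  have htrim : (μ.withDensity (μ⁻[X|m])).trim hm = (μ.withDensity X).trim hm := by
    refine @Measure.ext _ m _ _ fun s hs => ?_
    rw [trim_measurableSet_eq hm hs, trim_measurableSet_eq hm hs, withDensity_apply _ (hm s hs),
      withDensity_apply _ (hm s hs), setLIntegral_condLExp hm μ X hs]
  have hg' : AEMeasurable g μ := (hg.mono hm le_rfl).aemeasurable
  calc ∫⁻ ω, g ω * μ⁻[X|m] ω ∂μ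
      = ∫⁻ ω, g ω ∂μ.withDensity (μ⁻[X|m]) := by
        rw [lintegral_withDensity_eq_lintegral_mul₀ (by fun_prop) hg']
        simp only [Pi.mul_apply, mul_comm]
    _ = ∫⁻ ω, g ω ∂μ.withDensity X := by
        rw [← lintegral_trim hm hg, htrim, lintegral_trim hm hg]
    _ = ∫⁻ ω, g ω * X ω ∂μ := by
        rw [lintegral_withDensity_eq_lintegral_mul₀ hX hg']
        simp only [Pi.mul_apply, mul_comm]

variable {f g : Ω → ℝ}

theorem integrable_mul_of_integrable_mul_condExp (hm : m ≤ mΩ) [SigmaFinite (μ.trim hm)]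
    (hf : Integrable f μ) (hf0 : 0 ≤ᵐ[μ] f) (hg : Measurable[m] g)
    (hgf : Integrable (fun ω => g ω * μ[f | m] ω) μ) : Integrable (fun ω => g ω * f ω) μ := by
  -- `condExp_mul_of_stronglyMeasurable_left` presupposes the integrability to be proved here.
  have hlintegral : ∫⁻ ω, ‖g ω * f ω‖ₑ ∂μ = ∫⁻ ω, ‖g ω * μ[f | m] ω‖ₑ ∂μ := by
    simp only [enorm_mul]
    rw [← lintegral_mul_condLExp hm (g := fun ω => ‖g ω‖ₑ) (measurable_enorm.comp hg) hf.1.enorm]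
    refine lintegral_congr_ae ?_
    filter_upwards [condLExp_enorm m hf hf0] with ω hω
    rw [hω]
  exact ⟨(hg.mono hm le_rfl).aestronglyMeasurable.mul hf.1, hlintegral.trans_lt hgf.2⟩

theorem integral_mul_condExp (hm : m ≤ mΩ) [SigmaFinite (μ.trim hm)] (hf : Integrable f μ)
    (hg : Measurable[m] g) (hgf : Integrable (fun ω => g ω * f ω) μ) :
    ∫ ω, g ω * μ[f | m] ω ∂μ = ∫ ω, g ω * f ω ∂μ := by
  rw [← integral_condExp hm (f := fun ω => g ω * f ω)]
  exact integral_congr_ae (condExp_mul_of_stronglyMeasurable_left hg.stronglyMeasurable hgf hf).symm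

end ConditionalExpectation

namespace IsGamePlay

variable {d n t : ℕ} {Ω : Type*} {mΩ : MeasurableSpace Ω} {μ : Measure Ω} {𝒢 : Filtration ℕ mΩ}
  {S : Finset (EuclideanSpace ℝ (Fin d))} {ℓ V : ℕ → Ω → EuclideanSpace ℝ (Fin d)}
  {p : ℕ → Ω → EuclideanSpace ℝ (Fin d) → ℝ} {w : Ω → EuclideanSpace ℝ (Fin d)}

theorem measurable_action (h : IsGamePlay μ 𝒢 S n ℓ V p) (ht : t < n) : Measurable (V t) :=
  (h.action_measurable t ht).mono (𝒢.le _) le_rfl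

theorem measurable_weight_apply (h : IsGamePlay μ 𝒢 S n ℓ V p) (ht : t < n)
    (hmean : ∀ ω, ∑ v ∈ S, p t ω v • v = w ω) (i : Fin d) :
    Measurable[𝒢 t] fun ω => w ω i := by
  simp only [← hmean, WithLp.ofLp_sum, Finset.sum_apply, PiLp.smul_apply, smul_eq_mul]
  exact Finset.measurable_fun_sum _ fun v hv => (h.prob_measurable t ht v hv).mul_const (v i)

theorem apply_action_eq_sum_indicator (h : IsGamePlay μ 𝒢 S n ℓ V p) (ht : t < n)
    (f : Ω → EuclideanSpace ℝ (Fin d) → ℝ) :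
    (fun ω => f ω (V t ω)) = ∑ v ∈ S, (V t ⁻¹' {v}).indicator fun ω => f ω v := by
  ext ω
  rw [Finset.sum_apply, Finset.sum_eq_single_of_mem (V t ω) (h.action_mem t ht ω)]
  · simp
  · intro v _ hv
    simp [hv.symm]

theorem action_apply_eq_sum_indicator (h : IsGamePlay μ 𝒢 S n ℓ V p) (ht : t < n) (i : Fin d) :
    (fun ω => V t ω i) = ∑ v ∈ S, v i • (V t ⁻¹' {v}).indicator fun _ => (1 : ℝ) := by
  refine (h.apply_action_eq_sum_indicator ht fun _ v => v i).trans
    (Finset.sum_congr rfl fun v _ => ?_)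
  ext ω
  by_cases hω : V t ω = v <;> simp [hω]

variable [IsFiniteMeasure μ]

theorem integrable_indicator_action (h : IsGamePlay μ 𝒢 S n ℓ V p) (ht : t < n)
    (v : EuclideanSpace ℝ (Fin d)) :
    Integrable ((V t ⁻¹' {v}).indicator fun _ => (1 : ℝ)) μ :=
  (integrable_const 1).indicator (h.measurable_action ht (measurableSet_singleton v))

theorem integrable_action_apply (h : IsGamePlay μ 𝒢 S n ℓ V p) (ht : t < n) (i : Fin d) :
    Integrable (fun ω => V t ω i) μ := by
  rw [h.action_apply_eq_sum_indicator ht i]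
  exact integrable_finsetSum' _ fun v _ => (h.integrable_indicator_action ht v).smul (v i)

theorem condExp_action_apply (h : IsGamePlay μ 𝒢 S n ℓ V p) (ht : t < n)
    (hmean : ∀ ω, ∑ v ∈ S, p t ω v • v = w ω) (i : Fin d) :
    μ[fun ω => V t ω i | 𝒢 t] =ᵐ[μ] fun ω => w ω i := by
  have hterm : ∀ v ∈ S, ∀ᵐ ω ∂μ,
      μ[v i • (V t ⁻¹' {v}).indicator (fun _ => (1 : ℝ)) | 𝒢 t] ω = p t ω v * v i := by
    intro v hv
    filter_upwards [condExp_smul (v i) ((V t ⁻¹' {v}).indicator fun _ => (1 : ℝ)) (𝒢 t),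
      h.action_law t ht v hv] with ω hsmul hlaw
    rw [hsmul, Pi.smul_apply, hlaw, smul_eq_mul, mul_comm]
  rw [h.action_apply_eq_sum_indicator ht i]
  filter_upwards [condExp_finsetSum (fun v _ => (h.integrable_indicator_action ht v).smul (v i))
    (𝒢 t), (ae_ball_iff S.countable_toSet).2 hterm] with ω hsum hω
  rw [hsum, Finset.sum_apply, Finset.sum_congr rfl hω, ← hmean ω]
  simp

variable {g : Ω → ℝ} {i : Fin d}

theorem integrable_mul_action (h : IsGamePlay μ 𝒢 S n ℓ V p) (ht : t < n)
    (hmean : ∀ ω, ∑ v ∈ S, p t ω v • v = w ω) (hS : ∀ v ∈ S, 0 ≤ v i) (hg : Measurable[𝒢 t] g)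
    (hgw : Integrable (fun ω => g ω * w ω i) μ) : Integrable (fun ω => g ω * V t ω i) μ := by
  refine integrable_mul_of_integrable_mul_condExp (𝒢.le t) (h.integrable_action_apply ht i)
    (ae_of_all _ fun ω => hS _ (h.action_mem t ht ω)) hg (hgw.congr ?_)
  filter_upwards [h.condExp_action_apply ht hmean i] with ω hω
  rw [hω]

theorem integral_mul_action (h : IsGamePlay μ 𝒢 S n ℓ V p) (ht : t < n)
    (hmean : ∀ ω, ∑ v ∈ S, p t ω v • v = w ω) (hS : ∀ v ∈ S, 0 ≤ v i) (hg : Measurable[𝒢 t] g)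
    (hgw : Integrable (fun ω => g ω * w ω i) μ) :
    ∫ ω, g ω * V t ω i ∂μ = ∫ ω, g ω * w ω i ∂μ := by
  rw [← integral_mul_condExp (𝒢.le t) (h.integrable_action_apply ht i) hg
    (h.integrable_mul_action ht hmean hS hg hgw)]
  refine integral_congr_ae ?_
  filter_upwards [h.condExp_action_apply ht hmean i] with ω hω
  rw [hω]

end IsGamePlay

section ImportanceWeighted

variable {d : ℕ} {ℓ V w : EuclideanSpace ℝ (Fin d)}

theorem importanceWeighted_apply (ℓ V w : EuclideanSpace ℝ (Fin d)) (i : Fin d) :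
    importanceWeighted ℓ V w i = ℓ i / w i * V i := by
  rw [importanceWeighted, div_mul_eq_mul_div, mul_div_assoc]

theorem inner_importanceWeighted_self (hw : ∀ i, w i ≠ 0) :
    inner ℝ (importanceWeighted ℓ V w) w = inner ℝ ℓ V := by
  rw [PiLp.inner_apply, PiLp.inner_apply]
  refine Finset.sum_congr rfl fun i _ => ?_
  simp only [importanceWeighted_apply, RCLike.inner_apply, conj_trivial]
  field_simp [hw i]

theorem sq_importanceWeighted_mul_rpow_le {i : Fin d} (hℓ : ℓ i ∈ Set.Icc (0 : ℝ) 1)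
    (hV : V i ∈ Set.Icc (0 : ℝ) 1) (hw : 0 < w i) (r : ℝ) :
    importanceWeighted ℓ V w i ^ 2 * w i ^ (1 + r) ≤ w i ^ (r - 1) * V i := by
  have hpow : w i ^ (1 + r) = w i ^ (r - 1) * w i ^ 2 := by
    rw [← Real.rpow_two, ← Real.rpow_add hw]
    ring_nf
  have hsq : (ℓ i * V i) ^ 2 ≤ V i := by
    have hle : ℓ i * V i ≤ V i := mul_le_of_le_one_left hV.1 hℓ.2
    have hnonneg : 0 ≤ ℓ i * V i := mul_nonneg hℓ.1 hV.1
    nlinarith [hV.2]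
  calc importanceWeighted ℓ V w i ^ 2 * w i ^ (1 + r)
      = w i ^ (r - 1) * (ℓ i * V i) ^ 2 := by
        rw [hpow, importanceWeighted_apply]
        field_simp
    _ ≤ w i ^ (r - 1) * V i := mul_le_mul_of_nonneg_left hsq (by positivity)

end ImportanceWeighted

namespace IsGamePlay

variable {d n t : ℕ} {Ω : Type*} {mΩ : MeasurableSpace Ω} {μ : Measure Ω} {𝒢 : Filtration ℕ mΩ}
  {S : Finset (EuclideanSpace ℝ (Fin d))} {ℓ V : ℕ → Ω → EuclideanSpace ℝ (Fin d)}
  {p : ℕ → Ω → EuclideanSpace ℝ (Fin d) → ℝ} {w : Ω → EuclideanSpace ℝ (Fin d)}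

theorem measurable_loss_div_weight (h : IsGamePlay μ 𝒢 S n ℓ V p) (ht : t < n)
    (hmean : ∀ ω, ∑ v ∈ S, p t ω v • v = w ω) (i : Fin d) :
    Measurable[𝒢 t] fun ω => ℓ t ω i / w ω i :=
  ((EuclideanSpace.proj (𝕜 := ℝ) i).measurable.comp (h.loss_measurable t ht)).div
    (h.measurable_weight_apply ht hmean i)

variable [IsFiniteMeasure μ]

theorem integrable_importanceWeighted (h : IsGamePlay μ 𝒢 S n ℓ V p) (ht : t < n)
    (hmean : ∀ ω, ∑ v ∈ S, p t ω v • v = w ω) (hw : ∀ ω i, w ω i ≠ 0)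
    (hS : ∀ v ∈ S, ∀ i, 0 ≤ v i) (hℓ : Integrable (ℓ t) μ) :
    Integrable (fun ω => importanceWeighted (ℓ t ω) (V t ω) (w ω)) μ := by
  refine Integrable.of_eval_piLp fun i => ?_
  simp only [importanceWeighted_apply]
  refine h.integrable_mul_action ht hmean (fun v hv => hS v hv i)
    (h.measurable_loss_div_weight ht hmean i) ?_
  simpa only [div_mul_cancel₀ _ (hw _ i)] using hℓ.eval_piLp i

theorem integral_importanceWeighted (h : IsGamePlay μ 𝒢 S n ℓ V p) (ht : t < n)
    (hmean : ∀ ω, ∑ v ∈ S, p t ω v • v = w ω) (hw : ∀ ω i, w ω i ≠ 0)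
    (hS : ∀ v ∈ S, ∀ i, 0 ≤ v i) (hℓ : Integrable (ℓ t) μ) :
    ∫ ω, importanceWeighted (ℓ t ω) (V t ω) (w ω) ∂μ = ∫ ω, ℓ t ω ∂μ := by
  ext i
  rw [eval_integral_piLp (h.integrable_importanceWeighted ht hmean hw hS hℓ).eval_piLp,
    eval_integral_piLp hℓ.eval_piLp]
  simp only [importanceWeighted_apply]
  rw [h.integral_mul_action ht hmean (fun v hv => hS v hv i)
    (h.measurable_loss_div_weight ht hmean i)]
  all_goals simp only [div_mul_cancel₀ _ (hw _ i)]
  exact hℓ.eval_piLp i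

theorem integrable_rpow_sub_one_mul_weight (h : IsGamePlay μ 𝒢 S n ℓ V p) (ht : t < n)
    (hmean : ∀ ω, ∑ v ∈ S, p t ω v • v = w ω) {i : Fin d} (hw : ∀ ω, w ω i ∈ Set.Ioc (0 : ℝ) 1)
    {r : ℝ} (hr : 0 ≤ r) : Integrable (fun ω => w ω i ^ (r - 1) * w ω i) μ := by
  have hmeas : Measurable fun ω => w ω i ^ r :=
    ((h.measurable_weight_apply ht hmean i).mono (𝒢.le t) le_rfl).pow_const r
  simp only [← Real.rpow_add_one (hw _).1.ne', sub_add_cancel]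
  exact Integrable.of_mem_Icc 0 1 hmeas.aemeasurable (ae_of_all _ fun ω =>
    ⟨Real.rpow_nonneg (hw ω).1.le r, Real.rpow_le_one (hw ω).1.le (hw ω).2 hr⟩)

theorem integrable_rpow_sub_one_mul_action (h : IsGamePlay μ 𝒢 S n ℓ V p) (ht : t < n)
    (hmean : ∀ ω, ∑ v ∈ S, p t ω v • v = w ω) {i : Fin d} (hS : ∀ v ∈ S, 0 ≤ v i)
    (hw : ∀ ω, w ω i ∈ Set.Ioc (0 : ℝ) 1) {r : ℝ} (hr : 0 ≤ r) :
    Integrable (fun ω => w ω i ^ (r - 1) * V t ω i) μ :=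
  h.integrable_mul_action ht hmean hS
    ((h.measurable_weight_apply ht hmean i).pow_const (r - 1))
    (h.integrable_rpow_sub_one_mul_weight ht hmean hw hr)

theorem integral_rpow_sub_one_mul_action_le (h : IsGamePlay μ 𝒢 S n ℓ V p) (ht : t < n)
    (hmean : ∀ ω, ∑ v ∈ S, p t ω v • v = w ω) {i : Fin d} (hS : ∀ v ∈ S, 0 ≤ v i)
    (hw : ∀ ω, w ω i ∈ Set.Ioc (0 : ℝ) 1) {r : ℝ} (hr : 0 ≤ r) :
    ∫ ω, w ω i ^ (r - 1) * V t ω i ∂μ ≤ μ.real Set.univ := by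
  have hint := h.integrable_rpow_sub_one_mul_weight ht hmean hw hr
  rw [h.integral_mul_action ht hmean hS
    ((h.measurable_weight_apply ht hmean i).pow_const (r - 1)) hint]
  have hle (ω : Ω) : w ω i ^ (r - 1) * w ω i ≤ 1 := by
    rw [← Real.rpow_add_one (hw ω).1.ne', sub_add_cancel]
    exact Real.rpow_le_one (hw ω).1.le (hw ω).2 hr
  simpa using integral_mono hint (integrable_const 1) hle

theorem integrable_sum_rpow_sub_one_mul_action (h : IsGamePlay μ 𝒢 S n ℓ V p) (ht : t < n)
    (hmean : ∀ ω, ∑ v ∈ S, p t ω v • v = w ω) (hS : ∀ v ∈ S, ∀ i, 0 ≤ v i)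
    (hw : ∀ ω i, w ω i ∈ Set.Ioc (0 : ℝ) 1) {r : ℝ} (hr : 0 ≤ r) :
    Integrable (fun ω => ∑ i, w ω i ^ (r - 1) * V t ω i) μ :=
  integrable_finsetSum _ fun i _ => h.integrable_rpow_sub_one_mul_action ht hmean
    (fun v hv => hS v hv i) (fun ω => hw ω i) hr

theorem integral_sum_rpow_sub_one_mul_action_le (h : IsGamePlay μ 𝒢 S n ℓ V p) (ht : t < n)
    (hmean : ∀ ω, ∑ v ∈ S, p t ω v • v = w ω) (hS : ∀ v ∈ S, ∀ i, 0 ≤ v i)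
    (hw : ∀ ω i, w ω i ∈ Set.Ioc (0 : ℝ) 1) {r : ℝ} (hr : 0 ≤ r) :
    ∫ ω, ∑ i, w ω i ^ (r - 1) * V t ω i ∂μ ≤ d * μ.real Set.univ := by
  rw [integral_finsetSum _ fun i _ => h.integrable_rpow_sub_one_mul_action ht hmean
    (fun v hv => hS v hv i) (fun ω => hw ω i) hr]
  simpa using Finset.sum_le_sum fun i (_ : i ∈ Finset.univ) =>
    h.integral_rpow_sub_one_mul_action_le ht hmean (fun v hv => hS v hv i) (fun ω => hw ω i) hr

end IsGamePlay

namespace IsCleb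

variable {d n : ℕ} {q η : ℝ} {S : Finset (EuclideanSpace ℝ (Fin d))}
  {D : Set (EuclideanSpace ℝ (Fin d))} {F : EuclideanSpace ℝ (Fin d) → ℝ}
  {est ℓ V w : ℕ → EuclideanSpace ℝ (Fin d)}
  {p : ℕ → EuclideanSpace ℝ (Fin d) → ℝ}

theorem weight_apply_pos (h : IsCleb (orthant d 0) F S n est w p) {t : ℕ} (ht : t ≤ n)
    (i : Fin d) : 0 < w t i := by
  have hint := (h.weight_mem t ht).2
  rw [interior_orthant] at hint
  exact hint i

theorem weight_apply_le (h : IsCleb D F S n est w p) {i : Fin d} {b : ℝ}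
    (hS : ∀ v ∈ S, v i ≤ b) {t : ℕ} (ht : t ≤ n) : w t i ≤ b := by
  have hsub : convexHull ℝ (S : Set (EuclideanSpace ℝ (Fin d))) ⊆
      (EuclideanSpace.proj i : EuclideanSpace ℝ (Fin d) →L[ℝ] ℝ).toLinearMap ⁻¹' Set.Iic b :=
    convexHull_min hS ((convex_Iic b).linear_preimage _)
  exact hsub (h.weight_mem t ht).1

theorem sum_inner_loss_sub_sum_inner_estimate_le (hq : 1 < q) (hη : 0 < η)
    (h : IsCleb (orthant d 0) (linpolyF q η) S n
      (fun t => importanceWeighted (ℓ t) (V t) (w t)) w p)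
    (hw : IsMinOn (fun u => bregmanDiv (linpolyF q η) u (WithLp.toLp 2 fun _ => (1 : ℝ)))
      (convexHull ℝ (S : Set (EuclideanSpace ℝ (Fin d)))) (w 0))
    (hℓ : ∀ t < n, ∀ i, ℓ t i ∈ Set.Icc (0 : ℝ) 1) (hV : ∀ t < n, ∀ i, V t i ∈ Set.Icc (0 : ℝ) 1)
    {u : EuclideanSpace ℝ (Fin d)} (hu : u ∈ convexHull ℝ (S : Set (EuclideanSpace ℝ (Fin d))))
    (hu01 : ∀ i, u i ∈ Set.Icc (0 : ℝ) 1) :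
    ∑ t ∈ Finset.range n, inner ℝ (ℓ t) (V t) -
        ∑ t ∈ Finset.range n, inner ℝ (importanceWeighted (ℓ t) (V t) (w t)) u ≤
      d / ((q - 1) * η) +
        ∑ t ∈ Finset.range n, q * η / 2 * ∑ i, w t i ^ (1 / q - 1) * V t i := by
  have hwpos : ∀ t < n, ∀ i, 0 < w t i := fun t ht => h.weight_apply_pos ht.le
  have hest : ∀ t < n, ∀ i, 0 ≤ importanceWeighted (ℓ t) (V t) (w t) i := fun t ht i =>
    mul_nonneg (hℓ t ht i).1 (div_nonneg (hV t ht i).1 (hwpos t ht i).le)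
  calc ∑ t ∈ Finset.range n, inner ℝ (ℓ t) (V t) -
        ∑ t ∈ Finset.range n, inner ℝ (importanceWeighted (ℓ t) (V t) (w t)) u
      = ∑ t ∈ Finset.range n, inner ℝ (importanceWeighted (ℓ t) (V t) (w t)) (w t - u) := by
        rw [← Finset.sum_sub_distrib]
        refine Finset.sum_congr rfl fun t ht => ?_
        rw [inner_sub_right, inner_importanceWeighted_self fun i =>
          (hwpos t (Finset.mem_range.1 ht) i).ne']
    _ ≤ d / ((q - 1) * η) + ∑ t ∈ Finset.range n,
          q * η / 2 * ∑ i, importanceWeighted (ℓ t) (V t) (w t) i ^ 2 * w t i ^ (1 + 1 / q) :=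
        h.sum_inner_estimate_le_of_linpolyF hq hη hw hest hu hu01
    _ ≤ d / ((q - 1) * η) + ∑ t ∈ Finset.range n,
          q * η / 2 * ∑ i, w t i ^ (1 / q - 1) * V t i := by
        gcongr _ + ∑ t ∈ _, q * η / 2 * ∑ i, ?_ with t ht i
        rw [Finset.mem_range] at ht
        exact sq_importanceWeighted_mul_rpow_le (hℓ t ht i) (hV t ht i) (hwpos t ht i) (1 / q)

end IsCleb

theorem integral_const_add_sum_le {α ι : Type*} {mα : MeasurableSpace α} {ν : Measure α}
    [IsProbabilityMeasure ν] {s : Finset ι} {Y : ι → α → ℝ} (hY : ∀ i ∈ s, Integrable (Y i) ν)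
    {b : ℝ} (hb : ∀ i ∈ s, ∫ x, Y i x ∂ν ≤ b) (a : ℝ) :
    ∫ x, (a + ∑ i ∈ s, Y i x) ∂ν ≤ a + s.card * b := by
  rw [integral_add (integrable_const a) (integrable_finsetSum s hY), integral_finsetSum s hY,
    integral_const, probReal_univ, one_smul, ← nsmul_eq_mul]
  gcongr
  exact Finset.sum_le_card_nsmul s _ b hb

section Regret

variable {d n : ℕ} {q η : ℝ} {S : Finset (EuclideanSpace ℝ (Fin d))} {Ω : Type*}
  {mΩ : MeasurableSpace Ω} {μ : Measure Ω} {𝒢 : Filtration ℕ mΩ}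
  {ℓ V w : ℕ → Ω → EuclideanSpace ℝ (Fin d)} {p : ℕ → Ω → EuclideanSpace ℝ (Fin d) → ℝ}

theorem LInftyAssumption.apply_le_one (hL : LInftyAssumption n ℓ) {t : ℕ} (ht : t < n) (ω : Ω)
    (i : Fin d) : ℓ t ω i ≤ 1 :=
  (le_abs_self _).trans ((norm_le_pi_norm (WithLp.ofLp (ℓ t ω)) i).trans (hL t ht ω))

theorem regret_le_of_forall_sub_le {est : ℕ → Ω → EuclideanSpace ℝ (Fin d)} {B : Ω → ℝ}
    (hS : S.Nonempty)
    (hloss : ∀ t < n, Integrable (fun ω => inner ℝ (ℓ t ω) (V t ω)) μ)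
    (hest : ∀ t < n, Integrable (est t) μ)
    (hunbiased : ∀ t < n, ∀ u, ∫ ω, inner ℝ (est t ω) u ∂μ = ∫ ω, inner ℝ (ℓ t ω) u ∂μ)
    (hℓ : ∀ t < n, Integrable (ℓ t) μ) (hB : Integrable B μ)
    (hle : ∀ ω, ∀ u ∈ S, ∑ t ∈ Finset.range n, inner ℝ (ℓ t ω) (V t ω) -
      ∑ t ∈ Finset.range n, inner ℝ (est t ω) u ≤ B ω) :
    regret μ S hS n ℓ V ≤ ∫ ω, B ω ∂μ := by
  obtain ⟨u, hu, hinf⟩ := S.exists_mem_eq_inf' hS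
    fun v => ∫ ω, ∑ t ∈ Finset.range n, inner ℝ (ℓ t ω) v ∂μ
  have hloss_sum := integrable_finsetSum (Finset.range n) fun t ht =>
    hloss t (Finset.mem_range.1 ht)
  have hest_sum := integrable_finsetSum (Finset.range n) fun t ht =>
    (hest t (Finset.mem_range.1 ht)).inner_const (𝕜 := ℝ) u
  have hcomparator : ∫ ω, ∑ t ∈ Finset.range n, inner ℝ (ℓ t ω) u ∂μ =
      ∫ ω, ∑ t ∈ Finset.range n, inner ℝ (est t ω) u ∂μ := by
    rw [integral_finsetSum _ fun t ht => (hℓ t (Finset.mem_range.1 ht)).inner_const u,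
      integral_finsetSum _ fun t ht => (hest t (Finset.mem_range.1 ht)).inner_const u]
    exact Finset.sum_congr rfl fun t ht => (hunbiased t (Finset.mem_range.1 ht) u).symm
  rw [regret, hinf, hcomparator, ← integral_sub hloss_sum hest_sum]
  exact integral_mono (hloss_sum.sub hest_sum) hB fun ω => hle ω u hu

theorem IsGamePlay.integrable_inner_loss_action (h : IsGamePlay μ 𝒢 S n ℓ V p) {t : ℕ}
    (ht : t < n) (hℓ : Integrable (ℓ t) μ) :
    Integrable (fun ω => inner ℝ (ℓ t ω) (V t ω)) μ := by
  rw [h.apply_action_eq_sum_indicator ht fun ω v => inner ℝ (ℓ t ω) v]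
  exact integrable_finsetSum' _ fun v _ =>
    (hℓ.inner_const v).indicator (h.measurable_action ht (measurableSet_singleton v))

variable [IsFiniteMeasure μ]

theorem IsGamePlay.integrable_loss (h : IsGamePlay μ 𝒢 S n ℓ V p) (hL : LInftyAssumption n ℓ)
    {t : ℕ} (ht : t < n) : Integrable (ℓ t) μ := by
  refine Integrable.of_eval_piLp fun i => Integrable.of_mem_Icc 0 1 ?_ (ae_of_all _ fun ω =>
    ⟨h.loss_nonneg t ht ω i, hL.apply_le_one ht ω i⟩)
  exact ((EuclideanSpace.proj (𝕜 := ℝ) i).measurable.comp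
    ((h.loss_measurable t ht).mono (𝒢.le t) le_rfl)).aemeasurable

theorem IsGamePlay.integral_inner_importanceWeighted (h : IsGamePlay μ 𝒢 S n ℓ V p) {t : ℕ}
    (ht : t < n) {x : Ω → EuclideanSpace ℝ (Fin d)} (hmean : ∀ ω, ∑ v ∈ S, p t ω v • v = x ω)
    (hx : ∀ ω i, x ω i ≠ 0) (hS : ∀ v ∈ S, ∀ i, 0 ≤ v i) (hℓ : Integrable (ℓ t) μ)
    (u : EuclideanSpace ℝ (Fin d)) :
    ∫ ω, inner ℝ (importanceWeighted (ℓ t ω) (V t ω) (x ω)) u ∂μ =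
      ∫ ω, inner ℝ (ℓ t ω) u ∂μ := by
  simp only [real_inner_comm u]
  rw [integral_inner (h.integrable_importanceWeighted ht hmean hx hS hℓ), integral_inner hℓ,
    h.integral_importanceWeighted ht hmean hx hS hℓ]

theorem linpoly_bound_eq (hq : 1 < q) (hn : 0 < n)
    (hη : η = Real.sqrt (2 / (q * (q - 1) * n))) :
    1 / ((q - 1) * η) + n * (q * η / 2) = Real.sqrt (2 * q * n / (q - 1)) := by
  have hq1 : 0 < q - 1 := sub_pos.2 hq
  have : (0 : ℝ) < n := Nat.cast_pos.2 hn
  have hη0 : 0 < η := by rw [hη]; positivity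
  have hη_sq : η ^ 2 = 2 / (q * (q - 1) * n) := by rw [hη, Real.sq_sqrt (by positivity)]
  have hbalance : 1 / ((q - 1) * η) = n * (q * η / 2) := by
    rw [eq_div_iff (by positivity)] at hη_sq
    field_simp
    linarith
  rw [hbalance, eq_comm, Real.sqrt_eq_iff_mul_self_eq (by positivity) (by positivity),
    show (n * (q * η / 2) + n * (q * η / 2)) * (n * (q * η / 2) + n * (q * η / 2)) =
      (n * q) ^ 2 * η ^ 2 by ring, hη_sq]
  field_simp


theorem regret_linpoly_le [IsProbabilityMeasure μ] (hq : 1 < q) (hη : 0 < η) (hS : S.Nonempty)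
    (hS01 : ∀ v ∈ S, ∀ i, v i ∈ Set.Icc (0 : ℝ) 1)
    (hplay : IsGamePlay μ 𝒢 S n ℓ V p) (hL : LInftyAssumption n ℓ)
    (hcleb : ∀ ω, IsCleb (orthant d 0) (linpolyF q η) S n
      (fun t => importanceWeighted (ℓ t ω) (V t ω) (w t ω)) (fun t => w t ω) (fun t => p t ω))
    (hw : ∀ ω, IsMinOn
      (fun u => bregmanDiv (linpolyF q η) u (WithLp.toLp 2 fun _ => (1 : ℝ)))
      (convexHull ℝ (S : Set (EuclideanSpace ℝ (Fin d)))) (w 0 ω)) :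
    regret μ S hS n ℓ V ≤ d / ((q - 1) * η) + n * (q * η / 2 * d) := by
  have hS0 : ∀ v ∈ S, ∀ i, 0 ≤ v i := fun v hv i => (hS01 v hv i).1
  have hmean : ∀ t < n, ∀ ω, ∑ v ∈ S, p t ω v • v = w t ω := fun t ht ω =>
    (hcleb ω).prob_mean t ht
  have hw01 : ∀ t < n, ∀ ω i, w t ω i ∈ Set.Ioc (0 : ℝ) 1 := fun t ht ω i =>
    ⟨(hcleb ω).weight_apply_pos ht.le i,
      (hcleb ω).weight_apply_le (fun v hv => (hS01 v hv i).2) ht.le⟩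
  have hwne : ∀ t < n, ∀ ω i, w t ω i ≠ 0 := fun t ht ω i => (hw01 t ht ω i).1.ne'
  have hℓ : ∀ t < n, Integrable (ℓ t) μ := fun t => hplay.integrable_loss hL
  have hr : 0 ≤ 1 / q := by positivity
  have hround : ∀ t ∈ Finset.range n,
      Integrable (fun ω => q * η / 2 * ∑ i, w t ω i ^ (1 / q - 1) * V t ω i) μ := fun t ht =>
    have ht := Finset.mem_range.1 ht
    (hplay.integrable_sum_rpow_sub_one_mul_action ht (hmean t ht) hS0 (hw01 t ht) hr).const_mul _
  have hround_le : ∀ t ∈ Finset.range n,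
      ∫ ω, q * η / 2 * ∑ i, w t ω i ^ (1 / q - 1) * V t ω i ∂μ ≤ q * η / 2 * d := by
    intro t ht
    rw [Finset.mem_range] at ht
    rw [integral_const_mul]
    gcongr
    simpa using hplay.integral_sum_rpow_sub_one_mul_action_le ht (hmean t ht) hS0 (hw01 t ht) hr
  have hexpect := integral_const_add_sum_le hround hround_le (d / ((q - 1) * η))
  rw [Finset.card_range] at hexpect
  refine le_trans (regret_le_of_forall_sub_le hS
    (fun t ht => hplay.integrable_inner_loss_action ht (hℓ t ht))
    (fun t ht => hplay.integrable_importanceWeighted ht (hmean t ht) (hwne t ht) hS0 (hℓ t ht))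
    (fun t ht => hplay.integral_inner_importanceWeighted ht (hmean t ht) (hwne t ht) hS0 (hℓ t ht))
    hℓ ((integrable_const _).add (integrable_finsetSum _ hround))
    fun ω u hu => (hcleb ω).sum_inner_loss_sub_sum_inner_estimate_le hq hη (hw ω)
      (fun t ht i => ⟨hplay.loss_nonneg t ht ω i, hL.apply_le_one ht ω i⟩)
      (fun t ht => hS01 _ (hplay.action_mem t ht ω)) (subset_convexHull ℝ _ hu) (hS01 u hu))
    hexpect

end Regret

theorem mainTheorem7_general {d n : ℕ} (hn : 0 < n) {q η : ℝ} (hq : 1 < q)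
    (hη : η = Real.sqrt (2 / (q * (q - 1) * (n : ℝ))))
    (S : Finset (EuclideanSpace ℝ (Fin d))) (hS : S.Nonempty)
    (hS01 : ∀ v ∈ S, ∀ i, v i ∈ Set.Icc (0 : ℝ) 1)
    {Ω : Type*} [mΩ : MeasurableSpace Ω] (μ : Measure Ω) [IsProbabilityMeasure μ]
    (𝒢 : Filtration ℕ mΩ)
    (ℓ V w : ℕ → Ω → EuclideanSpace ℝ (Fin d))
    (p : ℕ → Ω → EuclideanSpace ℝ (Fin d) → ℝ)
    (hplay : IsGamePlay μ 𝒢 S n ℓ V p)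
    (hL : LInftyAssumption n ℓ)
    (hcleb : ∀ ω, IsCleb (orthant d 0) (linpolyF q η) S n
      (fun t => importanceWeighted (ℓ t ω) (V t ω) (w t ω)) (fun t => w t ω) (fun t => p t ω))
    (hw : ∀ ω, IsArgminOn
      (fun u => bregmanDiv (linpolyF q η) u (WithLp.toLp 2 fun _ => (1 : ℝ)))
      (convexHull ℝ (S : Set (EuclideanSpace ℝ (Fin d)))) (w 0 ω)) :
    regret μ S hS n ℓ V ≤ (d : ℝ) * Real.sqrt (2 * q * (n : ℝ) / (q - 1)) := by
  have : 0 < q - 1 := sub_pos.2 hq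
  have hη_pos : 0 < η := by rw [hη]; positivity
  calc regret μ S hS n ℓ V
      ≤ d / ((q - 1) * η) + n * (q * η / 2 * d) :=
        regret_linpoly_le hq hη_pos hS hS01 hplay hL hcleb fun ω => (hw ω).2
    _ = d * (1 / ((q - 1) * η) + n * (q * η / 2)) := by ring
    _ = d * Real.sqrt (2 * q * n / (q - 1)) := by rw [linpoly_bound_eq hq hn hη]

theorem mainTheorem7 {d n : ℕ} (hn : 0 < n) {q η : ℝ} (hq : 1 < q)
    (hη : η = Real.sqrt (2 / (q * (q - 1) * (n : ℝ))))
    (S : Finset (EuclideanSpace ℝ (Fin d))) (hS : S.Nonempty)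
    (hS01 : ∀ v ∈ S, ∀ i, v i = 0 ∨ v i = 1)
    {Ω : Type*} [mΩ : MeasurableSpace Ω] (μ : Measure Ω) [IsProbabilityMeasure μ]
    (𝒢 : Filtration ℕ mΩ)
    (ℓ V w : ℕ → Ω → EuclideanSpace ℝ (Fin d))
    (p : ℕ → Ω → EuclideanSpace ℝ (Fin d) → ℝ)
    (hplay : IsGamePlay μ 𝒢 S n ℓ V p)
    (hL : LInftyAssumption n ℓ)
    (hcleb : ∀ ω, IsCleb (orthant d 0) (linpolyF q η) S n
      (fun t => importanceWeighted (ℓ t ω) (V t ω) (w t ω)) (fun t => w t ω) (fun t => p t ω))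
    (hw : ∀ ω, IsArgminOn
      (fun u => bregmanDiv (linpolyF q η) u (WithLp.toLp 2 fun _ => (1 : ℝ)))
      (convexHull ℝ (S : Set (EuclideanSpace ℝ (Fin d)))) (w 0 ω)) :
    regret μ S hS n ℓ V ≤ (d : ℝ) * Real.sqrt (2 * q * (n : ℝ) / (q - 1)) := by
  refine mainTheorem7_general hn hq hη S hS (fun v hv i => ?_) μ 𝒢 ℓ V w p hplay hL hcleb hw
  rcases hS01 v hv i with h | h <;> simp [h]
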